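/- Let $(\mathcal A,\varphi)$ be a $W^*$-probability space, i.e. $\mathcal A$ is a von Neumann algebra and $\varphi$ a faithful normal tracial state on $\mathcal A$, and let $\mathcal B\subseteq\mathcal A$ be a von Neumann subalgebra (with the same unit). For $a\in\mathcal A$, the conditional expectation $\mathbb E_\varphi[a\,|\,\mathcal B]$ is the unique $z\in\mathcal B$ such that $\varphi(ab)=\varphi(zb)$ for all $b\in\mathcal B$. The Boolean cumulants $\beta_n:\mathcal A^n\to\mathbb C$ ($n\ge 1$) are defined recursively by $\varphi(X_1\cdots X_n)=\sum_{\pi}\prod_{V\in\pi}\beta_{|V|}(X_i;\,i\in V)$, where $\pi$ runs over all partitions of $\{1,\dots,n\}$ into intervals, and the alternating Boolean cumulant generating function of $X,Y\in\mathcal A$ is $$\eta^Y_X(z)=\sum_{n=0}^\infty \beta_{2n+1}(Y,X,Y,\dots,X,Y)\,z^{2n+1}.$$ Let $Y\in\mathcal A$ be free from $\mathcal B$, i.e. the unital algebra generated by $Y$ is free from $\mathcal B$ with respect to $\varphi$: $\varphi(a_1\cdots a_n)=0$ for all $n\ge 1$ whenever $\varphi(a_k)=0$ for all $k$ and the $a_k$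 belong alternately to these two algebras. Let $X\in\mathcal B$ with $\|X\|\,\|Y\|<\tfrac15$. Then the series $\eta^Y_X(1)=\sum_{n\ge0}\beta_{2n+1}(Y,X,\dots,X,Y)$ converges absolutely, the elements $1-YX$, $1-XY$ and $1-\eta^Y_X(1)X$ are invertible in $\mathcal A$, and $$\mathbb E_\varphi\left[(1-YX)^{-1}Y\,|\,\mathcal B\right]=\eta^Y_X(1)\,\bigl(1-\eta^Y_X(1)X\bigr)^{-1},$$ $$\mathbb E_\varphi\left[(1-XY)^{-1}X\,|\,\mathcal B\right]=X\,\bigl(1-\eta^Y_X(1)X\bigr)^{-1}.$$ -/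

import Mathlib

open scoped ComplexOrder

/-- A faithful normal tracial state on a von Neumann algebra `A`. Normality is order continuity:
`φ` preserves least upper bounds of directed sets of self-adjoint elements. -/
structure IsFaithfulNormalTracialState {H : Type*} [NormedAddCommGroup H] [InnerProductSpace ℂ H]
    [CompleteSpace H] {A : VonNeumannAlgebra H} (φ : A.toStarSubalgebra →ₗ[ℂ] ℂ) : Prop where
  map_one : φ 1 = 1
  nonneg : ∀ a, 0 ≤ φ (star a * a)
  faithful : ∀ a, φ (star a * a) = 0 → a = 0
  tracial : ∀ a b, φ (a * b) = φ (b * a)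
  normal : ∀ (D : Set A.toStarSubalgebra) (a : A.toStarSubalgebra),
    D.Nonempty → (∀ d ∈ D, IsSelfAdjoint d) → DirectedOn (· ≤ ·) D → IsLUB D a →
      IsLUB (φ '' D) (φ a)

/-- A von Neumann subalgebra `B ≤ A`, regarded as a unital subalgebra of the algebra `A`. -/
noncomputable def vnSubalgebra {H : Type*} [NormedAddCommGroup H] [InnerProductSpace ℂ H]
    [CompleteSpace H] (A B : VonNeumannAlgebra H) : Subalgebra ℂ A.toStarSubalgebra :=
  B.toStarSubalgebra.toSubalgebra.comap A.toStarSubalgebra.toSubalgebra.val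

/-- Freeness of a family of unital subalgebras: every alternating product of (at least one)
centered elements, neighbours coming from different subalgebras, is centered. -/
def AreFree {M : Type*} [Ring M] [Algebra ℂ M] (φ : M →ₗ[ℂ] ℂ) {ι : Type*}
    (S : ι → Subalgebra ℂ M) : Prop :=
  ∀ (n : ℕ) (i : Fin (n + 1) → ι) (a : Fin (n + 1) → M),
    (∀ k, a k ∈ S (i k)) → (∀ k, φ (a k) = 0) → (∀ k : Fin n, i k.castSucc ≠ i k.succ) →
      φ (List.ofFn a).prod = 0

/-- An element is free from a subalgebra `S` if the unital algebra it generates and `S`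
are free. -/
def IsFreeFrom {M : Type*} [Ring M] [Algebra ℂ M] (φ : M →ₗ[ℂ] ℂ) (Y : M)
    (S : Subalgebra ℂ M) : Prop :=
  AreFree φ ![Algebra.adjoin ℂ {Y}, S]

/-- The Boolean cumulant `β_n(X_1, …, X_n)`, defined recursively by the moment-cumulant formula
`φ (X_1 ⋯ X_n) = ∑_π β_π(X_1, …, X_n)`, the sum being over all interval partitions `π` of
`{1, …, n}`. Interval partitions are encoded by compositions of `n`; the only one with at most one
block (for `n ≥ 1`) is the maximal partition, whose term is `β_n` itself. -/
noncomputable def booleanCumulant {M : Type*} [Ring M] [Algebra ℂ M] (φ : M →ₗ[ℂ] ℂ)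
    (n : ℕ) (X : Fin n → M) : ℂ :=
  φ (List.ofFn X).prod -
    ∑ c : {c : Composition n // 1 < c.length},
      ∏ i : Fin c.1.length, booleanCumulant φ (c.1.blocksFun i) (X ∘ c.1.embedding i)
termination_by n
decreasing_by
  have hn : 0 < n := by have := c.1.length_le; have := c.2; omega
  exact (Composition.ne_single_iff hn).1
    (fun h => by have := (Composition.eq_single_iff_length hn).1 h; have := c.2; omega) i

/-- The Boolean moment-cumulant formula. -/
theorem moment_eq_sum_booleanCumulant {M : Type*} [Ring M] [Algebra ℂ M] (φ : M →ₗ[ℂ] ℂ)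
    {n : ℕ} (hn : 0 < n) (X : Fin n → M) :
    φ (List.ofFn X).prod = ∑ c : Composition n,
      ∏ i : Fin c.length, booleanCumulant φ (c.blocksFun i) (X ∘ c.embedding i) := by
  classical
  have h1 : ∀ c : Composition n, ¬ 1 < c.length ↔ c = Composition.single n hn := fun c => by
    have := c.length_pos_of_pos hn
    rw [Composition.eq_single_iff_length hn]
    omega
  rw [← Fintype.sum_subtype_add_sum_subtype (fun c : Composition n => 1 < c.length)]
  have h2 : ∑ c : {c : Composition n // ¬ 1 < c.length},
      ∏ i : Fin c.1.length, booleanCumulant φ (c.1.blocksFun i) (X ∘ c.1.embedding i) =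
        booleanCumulant φ n X := by
    rw [Fintype.sum_eq_single ⟨Composition.single n hn, (h1 _).2 rfl⟩
      (fun c hc => absurd (Subtype.ext ((h1 _).1 c.2)) hc)]
    change ∏ i : Fin 1, booleanCumulant φ ((Composition.single n hn).blocksFun i)
      (X ∘ (Composition.single n hn).embedding i) = _
    rw [Fin.prod_univ_one]
    change booleanCumulant φ n (X ∘ (Composition.single n hn).embedding (0 : Fin 1)) = _
    congr 1
    funext k
    exact congrArg X (Composition.single_embedding hn k)
  rw [h2]
  conv_rhs => rw [booleanCumulant]
  ring

/-- The alternating Boolean cumulant `β_{2n+1}(Y, X, Y, …, X, Y)`. -/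
noncomputable def altBooleanCumulant {M : Type*} [Ring M] [Algebra ℂ M] (φ : M →ₗ[ℂ] ℂ)
    (Y X : M) (n : ℕ) : ℂ :=
  booleanCumulant φ (2 * n + 1) fun k => if Even (k : ℕ) then Y else X

/-- The alternating Boolean cumulant generating function
`η^Y_X(z) = ∑_{n ≥ 0} β_{2n+1}(Y, X, …, X, Y) z^{2n+1}`. -/
noncomputable def altBooleanGF {M : Type*} [Ring M] [Algebra ℂ M] (φ : M →ₗ[ℂ] ℂ)
    (Y X : M) (z : ℂ) : ℂ :=
  ∑' n : ℕ, altBooleanCumulant φ Y X n * z ^ (2 * n + 1)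

/-- `z` is the conditional expectation `E_φ[a | S]`: it is the element of `S` with
`φ (a b) = φ (z b)` for all `b ∈ S`. -/
def IsCondExp {M : Type*} [Ring M] [Algebra ℂ M] (φ : M →ₗ[ℂ] ℂ) (S : Subalgebra ℂ M)
    (a z : M) : Prop :=
  z ∈ S ∧ ∀ b ∈ S, φ (a * b) = φ (z * b)

/-- The conditional expectation of an element onto a von Neumann subalgebra is unique. -/
theorem IsCondExp.unique {H : Type*} [NormedAddCommGroup H] [InnerProductSpace ℂ H]
    [CompleteSpace H] {A B : VonNeumannAlgebra H} {φ : A.toStarSubalgebra →ₗ[ℂ] ℂ}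
    (hφ : IsFaithfulNormalTracialState φ) {a z w : A.toStarSubalgebra}
    (hz : IsCondExp φ (vnSubalgebra A B) a z) (hw : IsCondExp φ (vnSubalgebra A B) a w) :
    z = w := by
  have hmem : star (z - w) ∈ vnSubalgebra A B := by
    have h := sub_mem hz.1 hw.1
    exact B.star_mem' h
  have h := (hz.2 _ hmem).symm.trans (hw.2 _ hmem)
  rw [← sub_eq_zero, ← map_sub, ← sub_mul, hφ.tracial] at h
  exact sub_eq_zero.1 (hφ.faithful _ h)

/-!
Write `E` for the conditional expectation onto the subalgebra `S` containing `X`, and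
`M = (1 - YX)⁻¹ Y`. For scalars `s, t` put `u = (Y - s)(1 - tY)⁻¹` and `v = (X - t)(1 - sX)⁻¹`. Then
`(1 - tY)(1 - uv)(1 - sX) = (1 - st)(1 - YX)`, whence `M = (1 - sX)⁻¹ (1 - uv)⁻¹ (s + u)`
(`inverse_one_sub_mul_factor`). If `u` and `v` are centered, freeness kills every alternating word
`(uv)ⁿ u b` with `b ∈ S`; summing the Neumann series gives `E[(1 - uv)⁻¹ u] = 0` and
`E[(1 - uv)⁻¹] = 1`, so `E[M] = s (1 - sX)⁻¹`. Scalars making `u` and `v` centered are found as a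
fixed point of a contraction when `‖X‖ ‖Y‖` is small (`exists_centering_pair`); smallness also
provides `‖uv‖ < 1`. Since `u` is a limit of polynomials in `Y`, freeness is first extended to the
closures of the algebras (`AreFree.topologicalClosure`).

To see that `s` is the Boolean cumulant series, sort the interval partitions by their first block
(`moment_succ_eq_sum_firstBlock`). For alternating words this yields two linear equations between
generating functions of moments, whose unknowns are the series of the cumulants
`β_{2n+1}(Y, X, …, Y)` and of the cumulants `β_{2n+2}(Y, X, …, X)`. By the formula for `E[M]`, `s`
and `0` solve them, and the solution is unique; in particular the vanishing of the even cumulants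
never has to be proved beforehand.

The first-block recursion bounds the `n`-th Boolean cumulant by `2ⁿ⁻¹` times the product of the
norms, so for `‖X‖ ‖Y‖ < 1/5` the series converges and its sum `η` satisfies `‖η X‖ < 1`. The
restriction to small `‖X‖ ‖Y‖` is removed by replacing `X` with `zX`: both sides are holomorphic in
`z` on a disc of radius larger than `1` and agree near `0` (`map_inverse_one_sub_mul_mul`).
-/

/-! ### Neumann series -/

section Resolvent

variable {M : Type*} [NormedRing M] [CompleteSpace M]

theorem one_sub_mul_inverse_one_sub {a : M} (h : ‖a‖ < 1) : (1 - a) * Ring.inverse (1 - a) = 1 :=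
  Ring.mul_inverse_cancel _ (isUnit_one_sub_of_norm_lt_one h)

theorem inverse_one_sub_mul_one_sub {a : M} (h : ‖a‖ < 1) : Ring.inverse (1 - a) * (1 - a) = 1 :=
  Ring.inverse_mul_cancel _ (isUnit_one_sub_of_norm_lt_one h)

theorem norm_inverse_one_sub_le [NormOneClass M] {a : M} (h : ‖a‖ < 1) :
    ‖Ring.inverse (1 - a)‖ ≤ (1 - ‖a‖)⁻¹ := by
  rw [← geom_series_eq_inverse a h]
  simpa using tsum_geometric_le_of_norm_lt_one a h

theorem commute_inverse_one_sub {a c : M} (hc : Commute c a) (h : ‖a‖ < 1) :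
    Commute c (Ring.inverse (1 - a)) := by
  have hc' : Commute c (1 - a) := (Commute.one_right c).sub_right hc
  calc c * Ring.inverse (1 - a)
      = Ring.inverse (1 - a) * ((1 - a) * c) * Ring.inverse (1 - a) := by
        rw [← mul_assoc, inverse_one_sub_mul_one_sub h, one_mul]
    _ = Ring.inverse (1 - a) * c * ((1 - a) * Ring.inverse (1 - a)) := by
        rw [← hc'.eq]; simp only [mul_assoc]
    _ = _ := by rw [one_sub_mul_inverse_one_sub h, mul_one]

theorem inverse_one_sub_mem [NormedAlgebra ℂ M] {S : Subalgebra ℂ M} (hS : IsClosed (S : Set M))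
    {a : M} (ha : a ∈ S) (h : ‖a‖ < 1) : Ring.inverse (1 - a) ∈ S :=
  (hS.mem_of_tendsto (hasSum_geom_series_inverse a h)
    (Filter.Eventually.of_forall fun _ => sum_mem fun i _ => pow_mem ha i) :)

end Resolvent

/-! ### Freeness and Neumann series of alternating products -/

section Freeness

theorem continuous_of_norm_le {M : Type*} [NormedRing M] [NormedAlgebra ℂ M] {φ : M →ₗ[ℂ] ℂ}
    (hb : ∀ a, ‖φ a‖ ≤ ‖a‖) : Continuous φ :=
  AddMonoidHomClass.continuous_of_bound φ 1 (by simpa using hb)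

/-- Freeness passes to norm closures: a centered element of the closure is a limit of centered
elements, and the expectation of a product of fixed length is jointly continuous in the factors. -/
theorem AreFree.topologicalClosure {M : Type*} [NormedRing M] [NormedAlgebra ℂ M]
    {φ : M →ₗ[ℂ] ℂ} (hφ : Continuous φ) (h1 : φ 1 = 1) {ι : Type*} {S : ι → Subalgebra ℂ M}
    (h : AreFree φ S) : AreFree φ fun j => (S j).topologicalClosure := by
  intro n i a ha h0 hi
  have hcl : ∀ k, a k ∈ closure {x : M | x ∈ S (i k) ∧ φ x = 0} := fun k => by
    have hc : Continuous fun x : M => x - φ x • (1 : M) := by fun_prop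
    have := map_mem_closure hc (ha k) (t := {x : M | x ∈ S (i k) ∧ φ x = 0}) fun x hx =>
      ⟨sub_mem hx (Subalgebra.smul_mem _ (one_mem _) _), by simp [h1]⟩
    simpa [h0 k] using this
  have ha' : a ∈ closure (Set.univ.pi fun k => {x : M | x ∈ S (i k) ∧ φ x = 0}) := by
    rw [closure_pi_set]
    exact fun k _ => hcl k
  have hc : Continuous fun b : Fin (n + 1) → M => φ (List.ofFn b).prod := by
    refine hφ.comp ?_
    simp only [List.ofFn_eq_map]
    exact continuous_list_prod _ fun k _ => continuous_apply k
  have := map_mem_closure hc ha' (t := {0}) fun b hb =>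
    h n i b (fun k => (hb k trivial).1) (fun k => (hb k trivial).2) hi
  simpa using this

theorem prod_ofFn_alternating_odd {M : Type*} [Monoid M] (u v : M) (n : ℕ) :
    (List.ofFn fun k : Fin (2 * n + 1) => if Even (k : ℕ) then u else v).prod
      = (u * v) ^ n * u := by
  induction n with
  | zero => simp
  | succ n ih =>
    rw [show 2 * (n + 1) + 1 = (2 * n + 1) + 1 + 1 by ring, List.ofFn_succ, List.ofFn_succ]
    simp only [List.prod_cons, Fin.val_succ, Fin.val_zero]
    simp only [show ∀ m : ℕ, Even (m + 1 + 1) ↔ Even m from fun m => by grind]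
    rw [ih]
    simp [pow_succ', mul_assoc]

/-- The last factor `b` need not be centered: the words with last factor `b - φ b` and with last
factor `u` are both alternating and centered. -/
theorem AreFree.map_alternating_mul {M : Type*} [Ring M] [Algebra ℂ M] {φ : M →ₗ[ℂ] ℂ}
    (h1 : φ 1 = 1) {S : Fin 2 → Subalgebra ℂ M} (h : AreFree φ S) {u v b : M} (hu : u ∈ S 0)
    (hv : v ∈ S 1) (hb : b ∈ S 1) (hu0 : φ u = 0) (hv0 : φ v = 0) (n : ℕ) :
    φ ((u * v) ^ n * u * b) = 0 := by
  let i : ℕ → Fin 2 := fun k => if Even k then 0 else 1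
  have hi : ∀ k, i k ≠ i (k + 1) := fun k => by
    by_cases hk : Even k <;> simp [i, hk, Nat.even_add_one]
  let w : Fin (2 * n + 1) → M := fun k => if Even (k : ℕ) then u else v
  have hw : ∀ k : Fin (2 * n + 1), w k ∈ S (i k) := fun k => by
    by_cases hk : Even (k : ℕ) <;> simpa [w, i, hk]
  have hw0 : ∀ k, φ (w k) = 0 := fun k => by
    by_cases hk : Even (k : ℕ) <;> simpa [w, hk]
  have e1 : φ ((u * v) ^ n * u) = 0 := by
    rw [← prod_ofFn_alternating_odd]
    exact h (2 * n) (fun k => i k) w hw hw0 fun k => hi k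
  have e2 : φ ((u * v) ^ n * u * (b - φ b • 1)) = 0 := by
    have hb0 : φ (b - φ b • 1) = 0 := by simp [h1]
    have hbS : b - φ b • 1 ∈ S 1 := sub_mem hb (Subalgebra.smul_mem _ (one_mem _) _)
    have := h (2 * n + 1) (fun k => i k) (Fin.snoc (α := fun _ => M) w (b - φ b • 1))
      (fun k => ?_) (fun k => ?_) fun k => hi k
    · rw [List.ofFn_succ'] at this
      simpa only [List.concat_eq_append, List.prod_append, List.prod_singleton, Fin.snoc_castSucc,
        Fin.snoc_last, w, prod_ofFn_alternating_odd] using this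
    · refine Fin.lastCases ?_ (fun k => ?_) k
      · have : ¬ Even (2 * n + 1) := by grind
        simpa [i, this] using hbS
      · simpa using hw k
    · refine Fin.lastCases ?_ (fun k => ?_) k
      · simpa only [Fin.snoc_last] using hb0
      · simpa using hw0 k
  have : (u * v) ^ n * u * b = (u * v) ^ n * u * (b - φ b • 1) + φ b • ((u * v) ^ n * u) := by
    simp [mul_sub]
  rw [this, map_add, map_smul, e1, e2]
  simp

/-- The conditional expectation of `(1 - uv)⁻¹ u` onto `S 1` is `0`. -/
theorem AreFree.map_inverse_mul_mul {M : Type*} [NormedRing M] [NormedAlgebra ℂ M]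
    [CompleteSpace M] {φ : M →ₗ[ℂ] ℂ} (hφ : Continuous φ)
    (h1 : φ 1 = 1) {S : Fin 2 → Subalgebra ℂ M} (h : AreFree φ S) {u v b : M} (hu : u ∈ S 0)
    (hv : v ∈ S 1) (hb : b ∈ S 1) (hu0 : φ u = 0) (hv0 : φ v = 0) (huv : ‖u * v‖ < 1) :
    φ (Ring.inverse (1 - u * v) * (u * b)) = 0 := by
  have hs := ((hasSum_geom_series_inverse _ huv).mul_right (u * b)).map φ hφ
  refine hs.unique ?_
  convert! hasSum_zero with n
  simpa [mul_assoc] using h.map_alternating_mul h1 hu hv hb hu0 hv0 n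

/-- The conditional expectation of `(1 - uv)⁻¹` onto `S 1` is `1`. -/
theorem AreFree.map_inverse_mul {M : Type*} [NormedRing M] [NormedAlgebra ℂ M]
    [CompleteSpace M] {φ : M →ₗ[ℂ] ℂ} (hφ : Continuous φ)
    (h1 : φ 1 = 1) {S : Fin 2 → Subalgebra ℂ M} (h : AreFree φ S) {u v b : M} (hu : u ∈ S 0)
    (hv : v ∈ S 1) (hb : b ∈ S 1) (hu0 : φ u = 0) (hv0 : φ v = 0) (huv : ‖u * v‖ < 1) :
    φ (Ring.inverse (1 - u * v) * b) = φ b := by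
  have e : Ring.inverse (1 - u * v) * b = b + Ring.inverse (1 - u * v) * (u * (v * b)) := by
    have := inverse_one_sub_mul_one_sub huv
    calc _ = (Ring.inverse (1 - u * v) * (1 - u * v)) * b
          + Ring.inverse (1 - u * v) * (u * (v * b)) := by noncomm_ring
      _ = _ := by rw [this, one_mul]
  rw [e, map_add, h.map_inverse_mul_mul hφ h1 hu hv (mul_mem hv hb) hu0 hv0 huv, add_zero]

end Freeness

/-! ### The conditional expectation for small norms -/

section Subordination

/-- With `u = (Y - s)(1 - tY)⁻¹` and `v = (X - t)(1 - sX)⁻¹` one has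
`(1 - tY)(1 - uv)(1 - sX) = (1 - st)(1 - YX)`; the statement is the resulting factorization of
`(1 - YX)⁻¹ Y`. -/
theorem inverse_one_sub_mul_factor {M : Type*} [NormedRing M] [NormedAlgebra ℂ M]
    [CompleteSpace M] {X Y : M} {s t : ℂ} (hXY : ‖Y * X‖ < 1)
    (ht : ‖t • Y‖ < 1) (hs : ‖s • X‖ < 1) (hst : s * t ≠ 1) :
    let u := (Y - s • 1) * Ring.inverse (1 - t • Y)
    let v := (X - t • 1) * Ring.inverse (1 - s • X)
    ‖u * v‖ < 1 → Ring.inverse (1 - Y * X) * Y =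
      Ring.inverse (1 - s • X) * (Ring.inverse (1 - u * v) * (s • 1 + u)) := by
  intro u v huv
  have hY' := one_sub_mul_inverse_one_sub ht
  have hX := inverse_one_sub_mul_one_sub hs
  have hX' := one_sub_mul_inverse_one_sub hs
  have hu : (1 - t • Y) * u = Y - s • 1 := by
    have : Commute (Y - s • 1) (Ring.inverse (1 - t • Y)) :=
      commute_inverse_one_sub (((Commute.refl Y).sub_left
        ((Commute.one_left Y).smul_left s)).smul_right t) ht
    rw [show u = Ring.inverse (1 - t • Y) * (Y - s • 1) from this.eq, ← mul_assoc, hY', one_mul]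
  have hv : v * (1 - s • X) = X - t • 1 := by rw [mul_assoc, hX, mul_one]
  have key : (1 - t • Y) * (1 - u * v) * (1 - s • X) = (1 - s * t) • (1 - Y * X) := by
    have : ∀ p q : M, p * (1 - u * v) * q = p * q - (p * u) * (v * q) := fun p q => by noncomm_ring
    calc _ = (1 - t • Y) * (1 - s • X) - ((1 - t • Y) * u) * (v * (1 - s • X)) := this _ _
      _ = _ := by
        rw [hu, hv]
        simp only [mul_sub, sub_mul, smul_mul_assoc, mul_smul_comm, one_mul, mul_one, sub_smul,
          smul_sub, smul_smul, one_smul, mul_comm t s]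
        abel
  have key2 : (1 - t • Y) * (s • 1 + u) = (1 - s * t) • Y := by
    rw [mul_add, hu]
    simp only [mul_smul_comm, mul_one, sub_smul, smul_sub, smul_smul, one_smul]
    abel
  have hu' : IsUnit (1 - Y * X) := isUnit_one_sub_of_norm_lt_one hXY
  have hZ := one_sub_mul_inverse_one_sub huv
  set Z := Ring.inverse (1 - u * v)
  set RX := Ring.inverse (1 - s • X)
  have hW : (1 - s * t) • ((1 - Y * X) * (RX * (Z * (s • 1 + u)))) = (1 - s * t) • Y := by
    rw [← smul_mul_assoc, ← key, ← key2]
    have : ∀ p q r w : M, p * q * r * (RX * (Z * w)) = p * (q * ((r * RX) * Z)) * w :=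
      fun p q r w => by noncomm_ring
    rw [this, hX', one_mul, hZ, mul_one]
  rw [smul_right_inj (sub_ne_zero.2 hst.symm)] at hW
  refine (hu'.mul_right_inj).1 ?_
  rw [hW, ← mul_assoc, Ring.mul_inverse_cancel _ hu', one_mul]

variable {M : Type*} [NormedRing M] [NormedAlgebra ℂ M] [CompleteSpace M] [NormOneClass M]

/-- The quotient `φ (a (1 - t a)⁻¹) / φ ((1 - t a)⁻¹)`; it is the scalar `s` for which
`(a - s) (1 - t a)⁻¹` is centered. -/
noncomputable def centeringScalar (φ : M →ₗ[ℂ] ℂ) (a : M) (t : ℂ) : ℂ :=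
  φ (a * Ring.inverse (1 - t • a)) / φ (Ring.inverse (1 - t • a))

variable {φ : M →ₗ[ℂ] ℂ}

theorem norm_inverse_one_sub_smul_le {a : M} {t : ℂ} (ht : ‖t‖ * ‖a‖ ≤ 1 / 4) :
    ‖Ring.inverse (1 - t • a)‖ ≤ 4 / 3 := by
  have h : ‖t • a‖ ≤ 1 / 4 := (norm_smul_le _ _).trans ht
  refine (norm_inverse_one_sub_le (by linarith)).trans ?_
  rw [inv_le_comm₀ (by linarith) (by norm_num)]
  linarith

theorem le_norm_map_inverse_one_sub_smul (hb : ∀ a, ‖φ a‖ ≤ ‖a‖) (h1 : φ 1 = 1) {a : M} {t : ℂ}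
    (ht : ‖t‖ * ‖a‖ ≤ 1 / 4) : 2 / 3 ≤ ‖φ (Ring.inverse (1 - t • a))‖ := by
  have h : ‖t • a‖ ≤ 1 / 4 := (norm_smul_le _ _).trans ht
  have hR := norm_inverse_one_sub_smul_le ht
  have e : Ring.inverse (1 - t • a) = 1 + (t • a) * Ring.inverse (1 - t • a) := by
    have := one_sub_mul_inverse_one_sub (a := t • a) (by linarith)
    rw [sub_mul, one_mul, sub_eq_iff_eq_add] at this
    exact this
  have h2 : ‖φ ((t • a) * Ring.inverse (1 - t • a))‖ ≤ 1 / 3 := by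
    refine (hb _).trans ((norm_mul_le _ _).trans ?_)
    calc _ ≤ 1 / 4 * (4 / 3 : ℝ) := by gcongr
      _ = _ := by norm_num
  rw [e, map_add, h1]
  have := norm_sub_le_norm_add (1 : ℂ) (φ ((t • a) * Ring.inverse (1 - t • a)))
  rw [norm_one] at this
  linarith

theorem norm_centeringScalar_le (hb : ∀ a, ‖φ a‖ ≤ ‖a‖) (h1 : φ 1 = 1) {a : M} {t : ℂ}
    (ht : ‖t‖ * ‖a‖ ≤ 1 / 4) : ‖centeringScalar φ a t‖ ≤ 2 * ‖a‖ := by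
  have hR := norm_inverse_one_sub_smul_le ht
  have hg := le_norm_map_inverse_one_sub_smul hb h1 ht
  rw [centeringScalar, norm_div, div_le_iff₀ (by linarith)]
  calc _ ≤ ‖a‖ * (4 / 3) := (hb _).trans ((norm_mul_le _ _).trans (by gcongr))
    _ = 2 * ‖a‖ * (2 / 3) := by ring
    _ ≤ _ := by gcongr

theorem map_sub_centeringScalar_mul (hb : ∀ a, ‖φ a‖ ≤ ‖a‖) (h1 : φ 1 = 1) {a : M} {t : ℂ}
    (ht : ‖t‖ * ‖a‖ ≤ 1 / 4) :
    φ ((a - centeringScalar φ a t • 1) * Ring.inverse (1 - t • a)) = 0 := by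
  have hg := le_norm_map_inverse_one_sub_smul hb h1 ht
  have : φ (Ring.inverse (1 - t • a)) ≠ 0 := fun h => by simp [h] at hg; linarith
  rw [sub_mul, map_sub, smul_mul_assoc, one_mul, map_smul, smul_eq_mul, centeringScalar,
    div_mul_cancel₀ _ this, sub_self]

/-- The centering scalar is Lipschitz in `t`, by the resolvent identity. -/
theorem norm_centeringScalar_sub_le (hb : ∀ a, ‖φ a‖ ≤ ‖a‖) (h1 : φ 1 = 1) {a : M} {t t' : ℂ}
    (ht : ‖t‖ * ‖a‖ ≤ 1 / 4) (ht' : ‖t'‖ * ‖a‖ ≤ 1 / 4) :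
    ‖centeringScalar φ a t - centeringScalar φ a t'‖ ≤ 8 * ‖a‖ ^ 2 * ‖t - t'‖ := by
  have hR := norm_inverse_one_sub_smul_le ht
  have hR' := norm_inverse_one_sub_smul_le ht'
  have hg := le_norm_map_inverse_one_sub_smul hb h1 ht
  have hg' := le_norm_map_inverse_one_sub_smul hb h1 ht'
  have hc := norm_centeringScalar_le hb h1 ht'
  have hm := one_sub_mul_inverse_one_sub (a := t' • a)
    (by linarith [norm_smul_le t' a])
  have hm' := inverse_one_sub_mul_one_sub (a := t • a)
    (by linarith [norm_smul_le t a])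
  unfold centeringScalar at hc ⊢
  set R := Ring.inverse (1 - t • a)
  set R' := Ring.inverse (1 - t' • a)
  -- the resolvent identity
  have hRR : R - R' = (t - t') • (R * a * R') := by
    calc R - R' = R * ((1 - t' • a) * R') - (R * (1 - t • a)) * R' := by rw [hm, hm']; simp
      _ = R * ((1 - t' • a) - (1 - t • a)) * R' := by noncomm_ring
      _ = _ := by simp [← sub_smul]
  have hg0 : φ R ≠ 0 := fun h => by simp [h] at hg; linarith
  have hg0' : φ R' ≠ 0 := fun h => by simp [h] at hg'; linarith
  have e : φ (a * R) / φ R - φ (a * R') / φ R' =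
      (t - t') * (φ (a * (R * a * R')) - φ (a * R') / φ R' * φ (R * a * R')) / φ R := by
    have h2 : φ (a * R) = φ (a * R') + (t - t') * φ (a * (R * a * R')) := by
      rw [← smul_eq_mul (t - t'), ← map_smul, ← map_add, ← mul_smul_comm, ← hRR, ← mul_add,
        add_sub_cancel]
    have h3 : φ R = φ R' + (t - t') * φ (R * a * R') := by
      rw [← smul_eq_mul (t - t'), ← map_smul, ← map_add, ← hRR, add_sub_cancel]
    field_simp
    rw [h2]
    linear_combination (-φ (a * R')) * h3
  have hn : ‖R * a * R'‖ ≤ 16 / 9 * ‖a‖ := by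
    calc _ ≤ ‖R‖ * ‖a‖ * ‖R'‖ := norm_mul₃_le
      _ ≤ 4 / 3 * ‖a‖ * (4 / 3) := by gcongr
      _ = _ := by ring
  have hn2 : ‖φ (a * (R * a * R'))‖ ≤ 16 / 9 * ‖a‖ ^ 2 := by
    refine (hb _).trans ((norm_mul_le _ _).trans ?_)
    calc _ ≤ ‖a‖ * (16 / 9 * ‖a‖) := by gcongr
      _ = _ := by ring
  rw [e, norm_div, norm_mul, div_le_iff₀ (by linarith)]
  calc _ ≤ ‖t - t'‖ * (16 / 9 * ‖a‖ ^ 2 + 2 * ‖a‖ * (16 / 9 * ‖a‖)) := by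
        gcongr
        refine (norm_sub_le _ _).trans ?_
        rw [norm_mul (_ / _)]
        have := (hb (R * a * R')).trans hn
        gcongr
    _ = 8 * ‖a‖ ^ 2 * ‖t - t'‖ * (2 / 3) := by ring
    _ ≤ _ := by gcongr

/-- For small `‖X‖ ‖Y‖` there are `s` and `t` for which `(Y - s)(1 - tY)⁻¹` and `(X - t)(1 - sX)⁻¹`
are both centered: `t` is the fixed point of a contraction of the disc of radius `2 ‖X‖`. -/
theorem exists_centering_pair (hb : ∀ a, ‖φ a‖ ≤ ‖a‖) (h1 : φ 1 = 1) {X Y : M}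
    (hXY : ‖X‖ * ‖Y‖ ≤ 1 / 20) :
    ∃ s t : ℂ, ‖s‖ ≤ 2 * ‖Y‖ ∧ ‖t‖ ≤ 2 * ‖X‖ ∧
      centeringScalar φ Y t = s ∧ centeringScalar φ X s = t := by
  have hY : ∀ t : ℂ, ‖t‖ ≤ 2 * ‖X‖ → ‖t‖ * ‖Y‖ ≤ 1 / 4 := fun t ht => by
    calc _ ≤ 2 * ‖X‖ * ‖Y‖ := by gcongr
      _ ≤ _ := by linarith
  have hX : ∀ s : ℂ, ‖s‖ ≤ 2 * ‖Y‖ → ‖s‖ * ‖X‖ ≤ 1 / 4 := fun t ht => by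
    calc _ ≤ 2 * ‖Y‖ * ‖X‖ := by gcongr
      _ ≤ _ := by linarith
  let F : ℂ → ℂ := fun t => centeringScalar φ X (centeringScalar φ Y t)
  have hs : ∀ t : ℂ, ‖t‖ ≤ 2 * ‖X‖ → ‖centeringScalar φ Y t‖ ≤ 2 * ‖Y‖ := fun t ht =>
    norm_centeringScalar_le hb h1 (hY t ht)
  have hmaps : Set.MapsTo F (Metric.closedBall 0 (2 * ‖X‖)) (Metric.closedBall 0 (2 * ‖X‖)) := by
    intro t ht
    rw [mem_closedBall_zero_iff] at ht ⊢
    exact norm_centeringScalar_le hb h1 (hX _ (hs t ht))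
  have hlip : LipschitzOnWith (1 / 2) F (Metric.closedBall 0 (2 * ‖X‖)) := by
    refine LipschitzOnWith.of_dist_le_mul fun t ht t' ht' => ?_
    rw [mem_closedBall_zero_iff] at ht ht'
    rw [dist_eq_norm, dist_eq_norm]
    calc _ ≤ 8 * ‖X‖ ^ 2 * (8 * ‖Y‖ ^ 2 * ‖t - t'‖) :=
          (norm_centeringScalar_sub_le hb h1 (hX _ (hs t ht)) (hX _ (hs t' ht'))).trans
            (by gcongr; exact norm_centeringScalar_sub_le hb h1 (hY t ht) (hY t' ht'))
      _ = 64 * (‖X‖ * ‖Y‖) ^ 2 * ‖t - t'‖ := by ring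
      _ ≤ 64 * (1 / 20) ^ 2 * ‖t - t'‖ := by gcongr
      _ ≤ _ := by
        gcongr
        norm_num
  have hcontr : ContractingWith (1 / 2) (hmaps.restrict F _ _) :=
    ⟨by rw [← NNReal.coe_lt_coe]; norm_num, hlip.mapsToRestrict hmaps⟩
  obtain ⟨t, ht, hfix, -⟩ := hcontr.exists_fixedPoint' Metric.isClosed_closedBall.isComplete hmaps
    (x := 0) (by simp) (edist_ne_top _ _)
  rw [mem_closedBall_zero_iff] at ht
  exact ⟨centeringScalar φ Y t, t, hs t ht, ht, rfl, hfix⟩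

/-- For small `‖X‖ ‖Y‖`, the conditional expectation of `(1 - YX)⁻¹ Y` onto `S` is `s (1 - sX)⁻¹`
for some scalar `s`. The centered elements `u` and `v` satisfy `‖u‖ ≤ 4 ‖Y‖` and `‖v‖ ≤ 4 ‖X‖`, so
the bound on `‖X‖ ‖Y‖` makes the Neumann series of `uv` converge. -/
theorem exists_subordination (hb : ∀ a, ‖φ a‖ ≤ ‖a‖) (h1 : φ 1 = 1)
    (htr : ∀ a b, φ (a * b) = φ (b * a)) {S : Subalgebra ℂ M} (hS : IsClosed (S : Set M))
    {X Y : M} (hfree : IsFreeFrom φ Y S) (hX : X ∈ S) (hXY : ‖X‖ * ‖Y‖ ≤ 1 / 20) :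
    ∃ s : ℂ, ‖s‖ * ‖X‖ ≤ 1 / 4 ∧ ∀ b ∈ S,
      φ (Ring.inverse (1 - Y * X) * Y * b) = s * φ (Ring.inverse (1 - s • X) * b) := by
  obtain ⟨s, t, hs, ht, hst, hts⟩ := exists_centering_pair hb h1 hXY
  have hsX : ‖s‖ * ‖X‖ ≤ 1 / 4 := by
    calc _ ≤ 2 * ‖Y‖ * ‖X‖ := by gcongr
      _ ≤ _ := by linarith
  have htY : ‖t‖ * ‖Y‖ ≤ 1 / 4 := by
    calc _ ≤ 2 * ‖X‖ * ‖Y‖ := by gcongr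
      _ ≤ _ := by linarith
  have hsX' : ‖s • X‖ < 1 := by linarith [norm_smul_le s X]
  have htY' : ‖t • Y‖ < 1 := by linarith [norm_smul_le t Y]
  have hYX : ‖Y * X‖ < 1 := by linarith [norm_mul_le Y X]
  have hst1 : s * t ≠ 1 := fun h => by
    have : ‖s * t‖ ≤ 4 * (‖X‖ * ‖Y‖) := by
      rw [norm_mul]
      calc _ ≤ (2 * ‖Y‖) * (2 * ‖X‖) := by gcongr
        _ = _ := by ring
    rw [h, norm_one] at this
    linarith
  have hfac := inverse_one_sub_mul_factor hYX htY' hsX' hst1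
  have hu0 := map_sub_centeringScalar_mul hb h1 htY
  have hv0 := map_sub_centeringScalar_mul hb h1 hsX
  rw [hst] at hu0
  rw [hts] at hv0
  have hnu : ‖(Y - s • 1) * Ring.inverse (1 - t • Y)‖ ≤ 4 * ‖Y‖ := by
    refine (norm_mul_le _ _).trans ?_
    have : ‖Y - s • 1‖ ≤ ‖Y‖ + 2 * ‖Y‖ := (norm_sub_le _ _).trans (by
      gcongr
      rw [norm_smul, norm_one, mul_one]
      exact hs)
    calc _ ≤ (‖Y‖ + 2 * ‖Y‖) * (4 / 3) := by
          gcongr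
          exact norm_inverse_one_sub_smul_le htY
      _ = _ := by ring
  have hnv : ‖(X - t • 1) * Ring.inverse (1 - s • X)‖ ≤ 4 * ‖X‖ := by
    refine (norm_mul_le _ _).trans ?_
    have : ‖X - t • 1‖ ≤ ‖X‖ + 2 * ‖X‖ := (norm_sub_le _ _).trans (by
      gcongr
      rw [norm_smul, norm_one, mul_one]
      exact ht)
    calc _ ≤ (‖X‖ + 2 * ‖X‖) * (4 / 3) := by
          gcongr
          exact norm_inverse_one_sub_smul_le hsX
      _ = _ := by ring
  have hcl := AreFree.topologicalClosure (continuous_of_norm_le hb) h1 hfree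
  have hRX : Ring.inverse (1 - s • X) ∈ S :=
    inverse_one_sub_mem hS (Subalgebra.smul_mem _ hX _) hsX'
  have hcS : ∀ a ∈ S, a ∈ (S.topologicalClosure) := fun a ha => S.le_topologicalClosure ha
  have hYP : Y ∈ (Algebra.adjoin ℂ {Y}).topologicalClosure :=
    Subalgebra.le_topologicalClosure _ (Algebra.self_mem_adjoin_singleton ℂ Y)
  have huS : (Y - s • 1) * Ring.inverse (1 - t • Y) ∈ (Algebra.adjoin ℂ {Y}).topologicalClosure :=
    mul_mem (sub_mem hYP (Subalgebra.smul_mem _ (one_mem _) _))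
      (inverse_one_sub_mem (Subalgebra.isClosed_topologicalClosure _)
        (Subalgebra.smul_mem _ hYP _) htY')
  have hvS : (X - t • 1) * Ring.inverse (1 - s • X) ∈ S :=
    mul_mem (sub_mem hX (Subalgebra.smul_mem _ (one_mem _) _)) hRX
  set u := (Y - s • 1) * Ring.inverse (1 - t • Y)
  set v := (X - t • 1) * Ring.inverse (1 - s • X)
  have huv : ‖u * v‖ < 1 := by
    calc _ ≤ 4 * ‖Y‖ * (4 * ‖X‖) := (norm_mul_le _ _).trans (by gcongr)
      _ = 16 * (‖X‖ * ‖Y‖) := by ring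
      _ < 1 := by linarith
  refine ⟨s, hsX, fun b hbS => ?_⟩
  have hbR : b * Ring.inverse (1 - s • X) ∈ S := mul_mem hbS hRX
  have E1 := hcl.map_inverse_mul_mul (continuous_of_norm_le hb) h1 (u := u) (v := v) huS
    (hcS _ hvS) (hcS _ hbR) hu0 hv0 huv
  have E2 := hcl.map_inverse_mul (continuous_of_norm_le hb) h1 (u := u) (v := v) huS
    (hcS _ hvS) (hcS _ hbR) hu0 hv0 huv
  rw [hfac huv, mul_assoc, htr]
  have : Ring.inverse (1 - u * v) * (s • 1 + u) * b * Ring.inverse (1 - s • X)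
      = s • (Ring.inverse (1 - u * v) * (b * Ring.inverse (1 - s • X)))
        + Ring.inverse (1 - u * v) * (u * (b * Ring.inverse (1 - s • X))) := by
    simp only [mul_add, add_mul, mul_smul_comm, smul_mul_assoc, mul_one, mul_assoc]
  rw [this, map_add, map_smul, E1, E2, add_zero, smul_eq_mul, htr]

end Subordination

/-! ### The first-block recursion for Boolean cumulants -/

section FirstBlock

/-- The product of the weights `G i b` of the consecutive blocks of lengths `b` given by a list, the
first block starting at position `i`. -/
def blockWeight (G : ℕ → ℕ → ℂ) : ℕ → List ℕ → ℂ
  | _, [] => 1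
  | i, b :: l => G i b * blockWeight G (i + b) l

theorem prod_eq_blockWeight (G : ℕ → ℕ → ℂ) (l : List ℕ) (i : ℕ) :
    ∏ j : Fin l.length, G (i + (l.take j).sum) (l.get j) = blockWeight G i l := by
  induction l generalizing i with
  | nil => rfl
  | cons b l ih =>
    rw [blockWeight, ← ih]
    simp only [List.length_cons]
    rw [Fin.prod_univ_succ]
    simp [add_assoc]

theorem sum_blockWeight_zero (G : ℕ → ℕ → ℂ) (i : ℕ) :
    ∑ c : Composition 0, blockWeight G i c.blocks = 1 := by
  have hc : ∀ c : Composition 0, c.blocks = [] := fun c => (c.blocks_eq_nil).2 rfl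
  rw [Fintype.sum_eq_single (Composition.ones 0) fun c h =>
    absurd (Composition.ext ((hc c).trans (hc _).symm)) h, hc, blockWeight]

/-- Sorting the compositions of `n + 1` by their first block. -/
theorem sum_blockWeight_succ (G : ℕ → ℕ → ℂ) (i n : ℕ) :
    ∑ c : Composition (n + 1), blockWeight G i c.blocks =
      ∑ k ∈ Finset.range (n + 1),
        G i (k + 1) * ∑ c : Composition (n - k), blockWeight G (i + (k + 1)) c.blocks := by
  rw [Finset.sum_range]
  simp only [Finset.mul_sum]
  rw [← Fintype.sum_sigma']
  symm
  let e : (Σ k : Fin (n + 1), Composition (n - k)) → Composition (n + 1) := fun p =>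
    { blocks := (p.1 + 1) :: p.2.blocks
      blocks_pos := fun {j} hj => by
        rcases List.mem_cons.1 hj with rfl | hj
        · omega
        · exact p.2.blocks_pos hj
      blocks_sum := by
        have := p.1.is_lt
        rw [List.sum_cons, p.2.blocks_sum]
        omega }
  refine Fintype.sum_bijective e ⟨?_, ?_⟩ _ _ fun p => rfl
  · rintro ⟨k, c⟩ ⟨k', c'⟩ h
    have h' : ((k : ℕ) + 1) :: c.blocks = ((k' : ℕ) + 1) :: c'.blocks :=
      congrArg Composition.blocks h
    obtain ⟨h1, h2⟩ := List.cons.inj h'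
    obtain rfl : k = k' := Fin.ext (by omega)
    obtain rfl : c = c' := Composition.ext h2
    rfl
  · rintro ⟨bl, hpos, hsum⟩
    cases bl with
    | nil => simp at hsum
    | cons b l =>
      have hb : 0 < b := hpos (List.mem_cons_self ..)
      rw [List.sum_cons] at hsum
      refine ⟨⟨⟨b - 1, by omega⟩, ⟨l, fun hj => hpos (List.mem_cons_of_mem _ hj), ?_⟩⟩, ?_⟩
      · simp only
        omega
      · refine Composition.ext ?_
        simp only [e]
        congr 1
        omega

variable {M : Type*} [Ring M] [Algebra ℂ M]

/-- The moment-cumulant formula for a segment of a sequence, also for the empty segment. -/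
theorem moment_eq_sum_blockWeight {φ : M →ₗ[ℂ] ℂ} (h1 : φ 1 = 1) (f : ℕ → M) (i n : ℕ) :
    φ (List.ofFn fun k : Fin n => f (i + k)).prod = ∑ c : Composition n,
      blockWeight (fun i n => booleanCumulant φ n fun k : Fin n => f (i + k)) i c.blocks := by
  rcases Nat.eq_zero_or_pos n with rfl | hn
  · rw [sum_blockWeight_zero]
    simpa using h1
  · rw [moment_eq_sum_booleanCumulant φ hn]
    refine Fintype.sum_congr _ _ fun c => ?_
    rw [← prod_eq_blockWeight]
    refine Fintype.prod_congr _ _ fun j => ?_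
    change booleanCumulant φ (c.blocksFun j) _ = booleanCumulant φ (c.blocksFun j) _
    congr 1
    funext k
    simp [Composition.sizeUpTo, add_assoc]

/-- The moment-cumulant formula with the interval partitions sorted by their first block, the
remaining blocks being summed up to a moment. -/
theorem moment_succ_eq_sum_firstBlock {φ : M →ₗ[ℂ] ℂ} (h1 : φ 1 = 1) (f : ℕ → M) (n : ℕ) :
    φ (List.ofFn fun k : Fin (n + 1) => f k).prod = ∑ k ∈ Finset.range (n + 1),
      booleanCumulant φ (k + 1) (fun j : Fin (k + 1) => f j) *
        φ (List.ofFn fun j : Fin (n - k) => f (k + 1 + j)).prod := by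
  have := moment_eq_sum_blockWeight h1 f 0 (n + 1)
  rw [sum_blockWeight_succ] at this
  simp only [zero_add, ← moment_eq_sum_blockWeight h1] at this
  exact this

theorem norm_moment_le {M : Type*} [NormedRing M] [NormedAlgebra ℂ M] [NormOneClass M]
    {φ : M →ₗ[ℂ] ℂ} (hb : ∀ a, ‖φ a‖ ≤ ‖a‖) (f : ℕ → M) (i n : ℕ) :
    ‖φ (List.ofFn fun k : Fin n => f (i + k)).prod‖ ≤ ∏ k ∈ Finset.range n, ‖f (i + k)‖ := by
  refine (hb _).trans ((List.norm_prod_le _).trans_eq ?_)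
  rw [List.map_ofFn, List.prod_ofFn, Finset.prod_range]
  rfl

theorem norm_booleanCumulant_le {M : Type*} [NormedRing M] [NormedAlgebra ℂ M] [NormOneClass M]
    {φ : M →ₗ[ℂ] ℂ} (hb : ∀ a, ‖φ a‖ ≤ ‖a‖) (h1 : φ 1 = 1) (f : ℕ → M) (n : ℕ) :
    ‖booleanCumulant φ (n + 1) fun k : Fin (n + 1) => f k‖ ≤
      2 ^ n * ∏ k ∈ Finset.range (n + 1), ‖f k‖ := by
  induction n using Nat.strong_induction_on with
  | _ n ih =>
    have h := moment_succ_eq_sum_firstBlock h1 f n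
    rw [Finset.sum_range_succ] at h
    -- the term `k = n` is the cumulant itself
    have h0 : φ (List.ofFn fun j : Fin (n - n) => f (n + 1 + j)).prod = 1 := by
      rw [List.ofFn_congr (Nat.sub_self n)]
      simpa using h1
    rw [h0, mul_one, ← sub_eq_iff_eq_add'] at h
    rw [← h]
    have hm : ‖φ (List.ofFn fun k : Fin (n + 1) => f k).prod‖ ≤
        ∏ k ∈ Finset.range (n + 1), ‖f k‖ := by
      simpa using norm_moment_le hb f 0 (n + 1)
    have hk : ∀ k ∈ Finset.range n, ‖booleanCumulant φ (k + 1) (fun j : Fin (k + 1) => f j) *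
        φ (List.ofFn fun j : Fin (n - k) => f (k + 1 + j)).prod‖ ≤
          2 ^ k * ∏ k ∈ Finset.range (n + 1), ‖f k‖ := fun k hk => by
      rw [Finset.mem_range] at hk
      rw [norm_mul, show n + 1 = (k + 1) + (n - k) by omega, Finset.prod_range_add, ← mul_assoc]
      exact mul_le_mul (ih k hk) (norm_moment_le hb f _ _) (norm_nonneg _)
        (mul_nonneg (by positivity) (Finset.prod_nonneg fun _ _ => norm_nonneg _))
    calc _ ≤ ∏ k ∈ Finset.range (n + 1), ‖f k‖ +
          ∑ k ∈ Finset.range n, 2 ^ k * ∏ k ∈ Finset.range (n + 1), ‖f k‖ :=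
          (norm_sub_le _ _).trans (add_le_add hm (norm_sum_le_of_le _ hk))
      _ = _ := by
        rw [← Finset.sum_mul, geom_sum_eq (by norm_num)]
        ring

end FirstBlock

/-! ### Boolean cumulants of alternating words -/

section Alternating

theorem prod_ofFn_alternating_even {M : Type*} [Monoid M] (u v : M) (n : ℕ) :
    (List.ofFn fun k : Fin (2 * n) => if Even (k : ℕ) then u else v).prod = (u * v) ^ n := by
  induction n with
  | zero => simp
  | succ n ih =>
    rw [show 2 * (n + 1) = 2 * n + 1 + 1 by ring, List.ofFn_succ, List.ofFn_succ]
    simp only [List.prod_cons, Fin.val_succ, Fin.val_zero]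
    simp only [show ∀ m : ℕ, Even (m + 1 + 1) ↔ Even m from fun m => by grind]
    rw [ih]
    simp [pow_succ', mul_assoc]

theorem sum_range_two_mul {N : Type*} [AddCommMonoid N] (h : ℕ → N) (n : ℕ) :
    ∑ k ∈ Finset.range (2 * n), h k =
      ∑ j ∈ Finset.range n, h (2 * j) + ∑ j ∈ Finset.range n, h (2 * j + 1) := by
  induction n with
  | zero => simp
  | succ n ih =>
    rw [show 2 * (n + 1) = 2 * n + 1 + 1 by ring, Finset.sum_range_succ, Finset.sum_range_succ, ih,
      Finset.sum_range_succ, Finset.sum_range_succ]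
    abel

theorem prod_ofFn_odd_add {M : Type*} [Monoid M] (Y X : M) (j n : ℕ) :
    (List.ofFn fun k : Fin n => if Even (2 * j + 1 + (k : ℕ)) then Y else X).prod =
      (List.ofFn fun k : Fin n => if Even (k : ℕ) then X else Y).prod := by
  congr 2
  funext k
  by_cases hk : Even (k : ℕ)
  · rw [if_pos hk, if_neg (by grind)]
  · rw [if_neg hk, if_pos (by grind)]

theorem prod_ofFn_even_add {M : Type*} [Monoid M] (Y X : M) (j n : ℕ) :
    (List.ofFn fun k : Fin n => if Even (2 * j + 1 + 1 + (k : ℕ)) then Y else X).prod =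
      (List.ofFn fun k : Fin n => if Even (k : ℕ) then Y else X).prod := by
  congr 2
  funext k
  simp only [show Even (2 * j + 1 + 1 + (k : ℕ)) ↔ Even (k : ℕ) by grind]

variable {M : Type*} [Ring M] [Algebra ℂ M]

/-- The Boolean cumulant `β_{2n+2}(Y, X, …, Y, X)`. -/
noncomputable def evenBooleanCumulant (φ : M →ₗ[ℂ] ℂ) (Y X : M) (n : ℕ) : ℂ :=
  booleanCumulant φ (2 * n + 1 + 1) fun k => if Even (k : ℕ) then Y else X

variable {φ : M →ₗ[ℂ] ℂ}

/-- The first-block recursion for the words `YX⋯XY`; the second sum runs over `j < n`, so the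
subtraction `n - 1 - j` does not truncate. -/
theorem map_pow_mul_eq_sum (h1 : φ 1 = 1) (Y X : M) (n : ℕ) :
    φ ((Y * X) ^ n * Y) =
      ∑ j ∈ Finset.range (n + 1), altBooleanCumulant φ Y X j * φ ((X * Y) ^ (n - j)) +
      ∑ j ∈ Finset.range n, evenBooleanCumulant φ Y X j * φ ((Y * X) ^ (n - 1 - j) * Y) := by
  have h := moment_succ_eq_sum_firstBlock h1 (fun k => if Even k then Y else X) (2 * n)
  rw [prod_ofFn_alternating_odd, Finset.sum_range_succ, sum_range_two_mul, add_right_comm] at h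
  rw [h]
  have key : ∀ j ≤ n, φ (List.ofFn fun k : Fin (2 * n - 2 * j) =>
      if Even (2 * j + 1 + (k : ℕ)) then Y else X).prod = φ ((X * Y) ^ (n - j)) := fun j hj => by
    rw [prod_ofFn_odd_add, ← Nat.mul_sub, prod_ofFn_alternating_even]
  congr 1
  · rw [Finset.sum_range_succ, key n le_rfl]
    congr 1
    refine Finset.sum_congr rfl fun j hj => ?_
    rw [key j (Finset.mem_range.1 hj).le]
    rfl
  · refine Finset.sum_congr rfl fun j hj => ?_
    have hj := Finset.mem_range.1 hj
    rw [prod_ofFn_even_add, show 2 * n - (2 * j + 1) = 2 * (n - 1 - j) + 1 by omega,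
      prod_ofFn_alternating_odd]
    rfl

/-- The first-block recursion for the words `YX⋯YX`. -/
theorem map_pow_succ_eq_sum (h1 : φ 1 = 1) (Y X : M) (n : ℕ) :
    φ ((Y * X) ^ (n + 1)) =
      ∑ j ∈ Finset.range (n + 1), altBooleanCumulant φ Y X j * φ ((X * Y) ^ (n - j) * X) +
      ∑ j ∈ Finset.range (n + 1), evenBooleanCumulant φ Y X j * φ ((Y * X) ^ (n - j)) := by
  have h := moment_succ_eq_sum_firstBlock h1 (fun k => if Even k then Y else X) (2 * n + 1)
  rw [show 2 * n + 1 + 1 = 2 * (n + 1) by ring, prod_ofFn_alternating_even,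
    sum_range_two_mul] at h
  rw [h]
  congr 1
  · refine Finset.sum_congr rfl fun j hj => ?_
    have hj := Finset.mem_range.1 hj
    rw [prod_ofFn_odd_add, show 2 * n + 1 - 2 * j = 2 * (n - j) + 1 by omega,
      prod_ofFn_alternating_odd]
    rfl
  · refine Finset.sum_congr rfl fun j hj => ?_
    have hj := Finset.mem_range.1 hj
    rw [prod_ofFn_even_add, show 2 * n + 1 - (2 * j + 1) = 2 * (n - j) by omega,
      prod_ofFn_alternating_even]
    rfl

theorem prod_range_two_mul_alternating (y x : ℝ) (n : ℕ) :
    ∏ k ∈ Finset.range (2 * n), (if Even k then y else x) = (y * x) ^ n := by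
  rw [Finset.prod_range, ← List.prod_ofFn, prod_ofFn_alternating_even]

theorem norm_altBooleanCumulant_le {M : Type*} [NormedRing M] [NormedAlgebra ℂ M] [NormOneClass M]
    {φ : M →ₗ[ℂ] ℂ} (hb : ∀ a, ‖φ a‖ ≤ ‖a‖) (h1 : φ 1 = 1) (Y X : M) (n : ℕ) :
    ‖altBooleanCumulant φ Y X n‖ ≤ ‖Y‖ * (4 * (‖X‖ * ‖Y‖)) ^ n := by
  refine (norm_booleanCumulant_le hb h1 (fun k => if Even k then Y else X) (2 * n)).trans_eq ?_
  simp only [apply_ite norm]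
  rw [Finset.prod_range_succ, prod_range_two_mul_alternating, if_pos (even_two_mul n), pow_mul,
    mul_pow 4]
  ring

theorem norm_evenBooleanCumulant_le {M : Type*} [NormedRing M] [NormedAlgebra ℂ M]
    [NormOneClass M] {φ : M →ₗ[ℂ] ℂ} (hb : ∀ a, ‖φ a‖ ≤ ‖a‖) (h1 : φ 1 = 1) (Y X : M) (n : ℕ) :
    ‖evenBooleanCumulant φ Y X n‖ ≤ 2 * (‖X‖ * ‖Y‖) * (4 * (‖X‖ * ‖Y‖)) ^ n := by
  refine (norm_booleanCumulant_le hb h1 (fun k => if Even k then Y else X)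
    (2 * n + 1)).trans_eq ?_
  simp only [apply_ite norm]
  rw [show 2 * n + 1 + 1 = 2 * (n + 1) by ring, prod_range_two_mul_alternating, pow_succ, pow_mul,
    mul_pow 4]
  ring

end Alternating

/-! ### Generating functions -/

section GeneratingFunctions

/-- The convolution recursions of moments and cumulants, as identities between generating
functions. -/
theorem genFun_relations {e d p q x : ℕ → ℂ} {z : ℂ}
    (he : Summable fun n => ‖e n * z ^ n‖) (hd : Summable fun n => ‖d n * z ^ n‖)
    (hp : Summable fun n => ‖p n * z ^ n‖) (hq : Summable fun n => ‖q n * z ^ n‖)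
    (hx : Summable fun n => ‖x n * z ^ n‖)
    (hpn : ∀ n, p n = ∑ j ∈ Finset.range (n + 1), e j * q (n - j) +
      ∑ j ∈ Finset.range n, d j * p (n - 1 - j)) (hq0 : q 0 = 1)
    (hqn : ∀ n, q (n + 1) = ∑ j ∈ Finset.range (n + 1), e j * x (n - j) +
      ∑ j ∈ Finset.range (n + 1), d j * q (n - j)) :
    ∑' n, p n * z ^ n = (∑' n, e n * z ^ n) * (∑' n, q n * z ^ n) +
        z * ((∑' n, d n * z ^ n) * (∑' n, p n * z ^ n)) ∧
      ∑' n, q n * z ^ n = 1 + z * ((∑' n, e n * z ^ n) * (∑' n, x n * z ^ n) +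
        (∑' n, d n * z ^ n) * (∑' n, q n * z ^ n)) := by
  have hmul : ∀ f g : ℕ → ℂ, ∀ n, ∑ j ∈ Finset.range (n + 1), (f j * z ^ j) *
      (g (n - j) * z ^ (n - j)) = (∑ j ∈ Finset.range (n + 1), f j * g (n - j)) * z ^ n := by
    intro f g n
    rw [Finset.sum_mul]
    refine Finset.sum_congr rfl fun j hj => ?_
    have : z ^ n = z ^ j * z ^ (n - j) := by
      rw [← pow_add, Nat.add_sub_cancel' (Finset.mem_range_succ_iff.1 hj)]
    rw [this]
    ring
  have heq := hasSum_sum_range_mul_of_summable_norm he hq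
  have hex := hasSum_sum_range_mul_of_summable_norm he hx
  have hdp := hasSum_sum_range_mul_of_summable_norm hd hp
  have hdq := hasSum_sum_range_mul_of_summable_norm hd hq
  simp only [hmul] at heq hex hdp hdq
  constructor
  · have h2 : HasSum (fun n => (∑ j ∈ Finset.range n, d j * p (n - 1 - j)) * z ^ n)
        (z * ((∑' n, d n * z ^ n) * (∑' n, p n * z ^ n))) := by
      rw [← hasSum_nat_add_iff' 1]
      simp only [Finset.sum_range_one, Finset.range_zero, Finset.sum_empty, zero_mul, sub_zero]
      convert! hdp.mul_left z using 2 with n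
      rw [Nat.add_sub_cancel]
      ring
    refine (HasSum.tsum_eq ?_)
    convert! heq.add h2 using 2 with n
    rw [hpn n]
    ring
  · refine (HasSum.tsum_eq ?_)
    rw [← hasSum_nat_add_iff' 1]
    simp only [Finset.sum_range_one, hq0, pow_zero, mul_one, add_sub_cancel_left]
    convert! (hex.add hdq).mul_left z using 2 with n
    rw [hqn n]
    ring

theorem hasSum_map_pow_mul {M : Type*} [NormedRing M] [NormedAlgebra ℂ M] [CompleteSpace M]
    {φ : M →ₗ[ℂ] ℂ} (hb : ∀ a, ‖φ a‖ ≤ ‖a‖) {T : M} (c : M) {z : ℂ} (h : ‖z‖ * ‖T‖ < 1) :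
    HasSum (fun n => φ (T ^ n * c) * z ^ n) (φ (Ring.inverse (1 - z • T) * c)) := by
  have h' : ‖z • T‖ < 1 := (norm_smul_le _ _).trans_lt h
  convert! ((hasSum_geom_series_inverse _ h').mul_right c).map φ (continuous_of_norm_le hb)
    using 2 with n
  simp [smul_pow, mul_comm]

theorem summable_norm_map_pow_mul {M : Type*} [NormedRing M] [NormedAlgebra ℂ M]
    [NormOneClass M] {φ : M →ₗ[ℂ] ℂ}
    (hb : ∀ a, ‖φ a‖ ≤ ‖a‖) {T : M} (c : M) {z : ℂ}
    (h : ‖z‖ * ‖T‖ < 1) : Summable fun n => ‖φ (T ^ n * c) * z ^ n‖ := by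
  refine Summable.of_nonneg_of_le (fun _ => norm_nonneg _) (fun n => ?_)
    ((summable_geometric_of_lt_one (by positivity) h).mul_right ‖c‖)
  rw [norm_mul, norm_pow]
  calc _ ≤ ‖T‖ ^ n * ‖c‖ * ‖z‖ ^ n := by
        gcongr
        exact (hb _).trans ((norm_mul_le _ _).trans (by gcongr; exact norm_pow_le _ _))
    _ = _ := by ring

theorem summable_norm_mul_pow_of_le {e : ℕ → ℂ} {c r : ℝ} (hr : 0 ≤ r)
    (h : ∀ n, ‖e n‖ ≤ c * r ^ n) {z : ℂ} (hz : r * ‖z‖ < 1) :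
    Summable fun n => ‖e n * z ^ n‖ := by
  refine Summable.of_nonneg_of_le (fun _ => norm_nonneg _) (fun n => ?_)
    ((summable_geometric_of_lt_one (by positivity) hz).mul_left c)
  rw [norm_mul, norm_pow, mul_pow, ← mul_assoc]
  gcongr
  exact h n

variable {M : Type*} [NormedRing M] [NormedAlgebra ℂ M] [CompleteSpace M] [NormOneClass M]
  {φ : M →ₗ[ℂ] ℂ}

/-- For small `z`, the scalar in the conditional expectation of `(1 - zYX)⁻¹ Y` is the generating
function of the cumulants `β_{2n+1}(Y, X, …, Y)`: the first-block recursions determine it from the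
moments. -/
theorem map_inverse_one_sub_smul_mul_mul_of_small (hb : ∀ a, ‖φ a‖ ≤ ‖a‖) (h1 : φ 1 = 1)
    (htr : ∀ a b, φ (a * b) = φ (b * a)) {S : Subalgebra ℂ M} (hS : IsClosed (S : Set M))
    {X Y : M} (hfree : IsFreeFrom φ Y S) (hX : X ∈ S) {z : ℂ}
    (hz : ‖z‖ * (‖X‖ * ‖Y‖) ≤ 1 / 20) {b : M} (hbS : b ∈ S) :
    φ (Ring.inverse (1 - z • (Y * X)) * Y * b) = (∑' n, altBooleanCumulant φ Y X n * z ^ n) *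
      φ (Ring.inverse (1 - (∑' n, altBooleanCumulant φ Y X n * z ^ n) • z • X) * b) := by
  have hzX : z • X ∈ S := Subalgebra.smul_mem _ hX _
  obtain ⟨s, hs, hsub⟩ := exists_subordination hb h1 htr hS hfree hzX
    (by rw [norm_smul, mul_assoc]; exact hz)
  rw [mul_smul_comm] at hsub
  suffices (∑' n, altBooleanCumulant φ Y X n * z ^ n) = s by
    rw [this]
    exact hsub b hbS
  have hr4 : 4 * (‖X‖ * ‖Y‖) * ‖z‖ < 1 := by linarith
  have hYX : ‖z‖ * ‖Y * X‖ < 1 := by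
    calc _ ≤ ‖z‖ * (‖Y‖ * ‖X‖) := by gcongr; exact norm_mul_le _ _
      _ = ‖z‖ * (‖X‖ * ‖Y‖) := by ring
      _ < 1 := by linarith
  -- cyclic permutation turns the tails starting with `X` into words starting with `Y`
  have hcyc : ∀ n, φ ((X * Y) ^ n) = φ ((Y * X) ^ n * 1) := fun n => by
    rw [mul_one]
    cases n with
    | zero => simp
    | succ n => rw [pow_succ', mul_assoc, htr, mul_assoc, mul_pow_mul, ← mul_assoc, ← pow_succ']
  have hcycX : ∀ n, φ ((X * Y) ^ n * X) = φ ((Y * X) ^ n * X) := fun n => by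
    rw [mul_pow_mul, htr]
  obtain ⟨hP, hQ⟩ := genFun_relations (e := altBooleanCumulant φ Y X)
    (d := evenBooleanCumulant φ Y X) (p := fun n => φ ((Y * X) ^ n * Y))
    (q := fun n => φ ((Y * X) ^ n * 1)) (x := fun n => φ ((Y * X) ^ n * X)) (z := z)
    (summable_norm_mul_pow_of_le (by positivity) (norm_altBooleanCumulant_le hb h1 Y X) hr4)
    (summable_norm_mul_pow_of_le (by positivity) (norm_evenBooleanCumulant_le hb h1 Y X) hr4)
    (summable_norm_map_pow_mul hb _ hYX) (summable_norm_map_pow_mul hb _ hYX)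
    (summable_norm_map_pow_mul hb _ hYX)
    (fun n => by simpa only [hcyc] using map_pow_mul_eq_sum h1 Y X n) (by simpa using h1)
    (fun n => by
      simpa only [hcyc, hcycX, mul_one] using map_pow_succ_eq_sum h1 Y X n)
  rw [(hasSum_map_pow_mul hb Y hYX).tsum_eq, (hasSum_map_pow_mul hb 1 hYX).tsum_eq] at hP
  rw [(hasSum_map_pow_mul hb X hYX).tsum_eq, (hasSum_map_pow_mul hb 1 hYX).tsum_eq] at hQ
  set E := ∑' n, altBooleanCumulant φ Y X n * z ^ n
  set D := ∑' n, evenBooleanCumulant φ Y X n * z ^ n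
  have hsX : ‖s • z • X‖ < 1 := (norm_smul_le _ _).trans_lt (by linarith)
  have hYX' : ‖z • (Y * X)‖ < 1 := (norm_smul_le _ _).trans_lt hYX
  have hR := inverse_one_sub_mul_one_sub hsX
  have hU := inverse_one_sub_mul_one_sub hYX'
  set R := Ring.inverse (1 - s • z • X)
  set U := Ring.inverse (1 - z • (Y * X))
  have hR' : R = 1 + s • (R * (z • X)) := by
    rw [← mul_smul_comm, ← hR]; noncomm_ring
  have hU' : U = 1 + U * Y * (z • X) := by
    rw [mul_smul_comm, mul_assoc, ← mul_smul_comm, ← hU]; noncomm_ring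
  have eP : φ (U * Y) = s * φ R := by simpa using hsub 1 (one_mem S)
  have eR : φ R = 1 + s * φ (R * (z • X)) := by
    conv_lhs => rw [hR']
    simp [h1]
  have eQ : φ (U * 1) = φ R := by
    conv_lhs => rw [mul_one, hU']
    rw [map_add, h1, hsub _ hzX, ← eR]
  have eX : z * φ (U * X) = φ (R * (z • X)) := by
    rw [← smul_eq_mul, ← map_smul, ← mul_smul_comm]
    conv_lhs => rw [hU', add_mul, one_mul, map_add, mul_assoc (U * Y), hsub _ (mul_mem hzX hzX)]
    conv_rhs => rw [hR']
    simp only [add_mul, one_mul, smul_mul_assoc, map_add, map_smul, smul_eq_mul, mul_assoc]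
  rw [eP, eQ] at hP
  rw [eQ] at hQ
  -- With `w = φ (R zX)`, the equations are `sφ(R) = E φ(R) + zDsφ(R)`, `φ(R) = 1 + E w + zDφ(R)`
  -- and `φ(R) = 1 + s w`; eliminating `D` and `w` leaves `E = s`.
  linear_combination -hP + s * hQ + s * E * eX - E * eR

end GeneratingFunctions

/-! ### Analytic continuation in the norm of `X` -/

section Continuation

theorem summable_norm_altBooleanCumulant_mul_pow {M : Type*} [NormedRing M] [NormedAlgebra ℂ M]
    [NormOneClass M] {φ : M →ₗ[ℂ] ℂ} (hb : ∀ a, ‖φ a‖ ≤ ‖a‖) (h1 : φ 1 = 1) (X Y : M)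
    {z : ℂ} (hz : ‖z‖ * (‖X‖ * ‖Y‖) < 1 / 4) :
    Summable fun n => ‖altBooleanCumulant φ Y X n * z ^ n‖ :=
  summable_norm_mul_pow_of_le (by positivity) (norm_altBooleanCumulant_le hb h1 Y X) (by linarith)

theorem norm_tsum_altBooleanCumulant_smul_lt {M : Type*} [NormedRing M] [NormedAlgebra ℂ M]
    [NormOneClass M] {φ : M →ₗ[ℂ] ℂ} (hb : ∀ a, ‖φ a‖ ≤ ‖a‖) (h1 : φ 1 = 1) {X Y : M}
    {z : ℂ} (hz : ‖z‖ * (‖X‖ * ‖Y‖) < 1 / 5) :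
    ‖(∑' n, altBooleanCumulant φ Y X n * z ^ n) • z • X‖ < 1 := by
  have hr : 0 ≤ ‖z‖ * (‖X‖ * ‖Y‖) := by positivity
  have hg := (hasSum_geometric_of_lt_one (r := 4 * (‖z‖ * (‖X‖ * ‖Y‖))) (by positivity)
    (by linarith)).mul_left ‖Y‖
  have hE : ‖∑' n, altBooleanCumulant φ Y X n * z ^ n‖ ≤
      ‖Y‖ * (1 - 4 * (‖z‖ * (‖X‖ * ‖Y‖)))⁻¹ := by
    refine tsum_of_norm_bounded hg fun n => ?_
    rw [norm_mul, norm_pow]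
    calc _ ≤ ‖Y‖ * (4 * (‖X‖ * ‖Y‖)) ^ n * ‖z‖ ^ n := by
          gcongr
          exact norm_altBooleanCumulant_le hb h1 Y X n
      _ = _ := by rw [mul_assoc, ← mul_pow]; ring
  calc _ ≤ ‖Y‖ * (1 - 4 * (‖z‖ * (‖X‖ * ‖Y‖)))⁻¹ * (‖z‖ * ‖X‖) := by
        rw [norm_smul, norm_smul]
        gcongr
    _ = (‖z‖ * (‖X‖ * ‖Y‖)) / (1 - 4 * (‖z‖ * (‖X‖ * ‖Y‖))) := by ring
    _ < 1 := by
      rw [div_lt_one (by linarith)]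
      linarith

variable {M : Type*} [NormedRing M] [NormedAlgebra ℂ M] [CompleteSpace M] [NormOneClass M]
  {φ : M →ₗ[ℂ] ℂ}

/-- The conditional expectation of `(1 - YX)⁻¹ Y`, by continuation from small `z` to `z = 1` in
`φ ((1 - zYX)⁻¹ Y b)`. -/
theorem map_inverse_one_sub_mul_mul (hb : ∀ a, ‖φ a‖ ≤ ‖a‖) (h1 : φ 1 = 1)
    (htr : ∀ a b, φ (a * b) = φ (b * a)) {S : Subalgebra ℂ M} (hS : IsClosed (S : Set M))
    {X Y : M} (hfree : IsFreeFrom φ Y S) (hX : X ∈ S) (hXY : ‖X‖ * ‖Y‖ < 1 / 5)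
    {b : M} (hbS : b ∈ S) :
    φ (Ring.inverse (1 - Y * X) * Y * b) = (∑' n, altBooleanCumulant φ Y X n) *
      φ (Ring.inverse (1 - (∑' n, altBooleanCumulant φ Y X n) • X) * b) := by
  -- a disc of radius larger than `1` on which all estimates remain valid
  obtain ⟨ρ, hρ1, hρ⟩ : ∃ ρ : ℝ, 1 < ρ ∧ ρ * (‖X‖ * ‖Y‖) < 1 / 5 := by
    have hc : Filter.Tendsto (fun ρ : ℝ => ρ * (‖X‖ * ‖Y‖)) (nhdsWithin 1 (Set.Ioi 1))
        (nhds (1 * (‖X‖ * ‖Y‖))) := (Continuous.tendsto (by fun_prop) 1).mono_left inf_le_left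
    exact ((eventually_mem_nhdsWithin).and
      (hc.eventually_lt_const (by rwa [one_mul]))).exists
  have hρz : ∀ z ∈ Metric.ball (0 : ℂ) ρ, ‖z‖ * (‖X‖ * ‖Y‖) < 1 / 5 := fun z hz => by
    rw [mem_ball_zero_iff] at hz
    exact (by gcongr : ‖z‖ * (‖X‖ * ‖Y‖) ≤ ρ * (‖X‖ * ‖Y‖)).trans_lt hρ
  let L : M →L[ℂ] ℂ := ⟨φ, continuous_of_norm_le hb⟩
  let E : ℂ → ℂ := fun z => ∑' n, altBooleanCumulant φ Y X n * z ^ n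
  have hE : DifferentiableOn ℂ E (Metric.ball 0 ρ) := by
    refine Complex.differentiableOn_tsum_of_summable_norm
      (u := fun n => ‖altBooleanCumulant φ Y X n * (ρ : ℂ) ^ n‖) ?_ (fun n => by fun_prop)
      Metric.isOpen_ball fun n z hz => ?_
    · refine summable_norm_altBooleanCumulant_mul_pow hb h1 X Y ?_
      rw [Complex.norm_real, Real.norm_of_nonneg (by linarith)]
      linarith
    · rw [mem_ball_zero_iff] at hz
      rw [norm_mul, norm_mul, norm_pow, norm_pow, Complex.norm_real,
        Real.norm_of_nonneg (by linarith)]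
      gcongr
  have hf : DifferentiableOn ℂ (fun z : ℂ => L (Ring.inverse (1 - z • (Y * X)) * Y * b))
      (Metric.ball 0 ρ) := fun z hz => by
    have hu : ‖z • (Y * X)‖ < 1 := by
      calc _ ≤ ‖z‖ * (‖Y‖ * ‖X‖) := by rw [norm_smul]; gcongr; exact norm_mul_le _ _
        _ < 1 := by linarith [hρz z hz]
    have hd : DifferentiableAt ℂ (fun z : ℂ => Ring.inverse (1 - z • (Y * X))) z :=
      DifferentiableAt.inverse (by fun_prop) (isUnit_one_sub_of_norm_lt_one hu)
    exact (L.differentiableAt.comp z ((hd.mul_const Y).mul_const b)).differentiableWithinAt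
  have hg : DifferentiableOn ℂ (fun z => E z * L (Ring.inverse (1 - E z • z • X) * b))
      (Metric.ball 0 ρ) := fun z hz => by
    have hEz := hE.differentiableAt (Metric.isOpen_ball.mem_nhds hz)
    have hd : DifferentiableAt ℂ (fun z : ℂ => Ring.inverse (1 - E z • z • X)) z :=
      DifferentiableAt.inverse ((differentiableAt_const _).sub
        (hEz.smul (differentiableAt_id.smul_const X)))
        (isUnit_one_sub_of_norm_lt_one (norm_tsum_altBooleanCumulant_smul_lt hb h1 (hρz z hz)))
    exact (hEz.mul (L.differentiableAt.comp z (hd.mul_const b))).differentiableWithinAt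
  have hev : (fun z : ℂ => L (Ring.inverse (1 - z • (Y * X)) * Y * b)) =ᶠ[nhds 0]
      fun z => E z * L (Ring.inverse (1 - E z • z • X) * b) := by
    have hc : Filter.Tendsto (fun z : ℂ => ‖z‖ * (‖X‖ * ‖Y‖)) (nhds 0) (nhds 0) := by
      simpa using (Continuous.tendsto (by fun_prop : Continuous
        fun z : ℂ => ‖z‖ * (‖X‖ * ‖Y‖)) 0)
    filter_upwards [hc.eventually_le_const (by norm_num : (0 : ℝ) < 1 / 20)] with z hz
    exact map_inverse_one_sub_smul_mul_mul_of_small hb h1 htr hS hfree hX hz hbS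
  have := (hf.analyticOnNhd Metric.isOpen_ball).eqOn_of_preconnected_of_eventuallyEq
    (hg.analyticOnNhd Metric.isOpen_ball) (convex_ball 0 ρ).isPreconnected
    (Metric.mem_ball_self (by linarith)) hev
    (show (1 : ℂ) ∈ Metric.ball 0 ρ by simpa using hρ1)
  simpa [E, L] using this

end Continuation

/-! ### States and von Neumann algebras -/

section State

/-- A state is a contraction: `|φ a|² ≤ φ (a⋆ a)` as the variance of `a` is nonnegative, and
`φ (a⋆ a) ≤ ‖a‖²` as `‖a‖² - a⋆ a` is of the form `c⋆ c`. -/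
theorem norm_map_le_of_state {A : Type*} [CStarAlgebra A] {φ : A →ₗ[ℂ] ℂ} (h1 : φ 1 = 1)
    (hφ : ∀ a, 0 ≤ φ (star a * a)) (a : A) : ‖φ a‖ ≤ ‖a‖ := by
  let _ := CStarAlgebra.spectralOrder A
  have := CStarAlgebra.spectralOrderedRing A
  have hle : ((φ (star a * a)).re) ≤ ‖a‖ ^ 2 := by
    obtain ⟨c, hc⟩ := CStarAlgebra.nonneg_iff_eq_star_mul_self.1
      (sub_nonneg.2 (CStarAlgebra.star_mul_le_algebraMap_norm_sq (a := a)))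
    have := hφ c
    rw [← hc, map_sub, Algebra.algebraMap_eq_smul_one, ← Complex.coe_smul, map_smul, h1] at this
    have := (Complex.nonneg_iff.1 this).1
    simpa [← Complex.ofReal_pow] using this
  -- positivity at `1 + a` and at `1 + i a`
  have hstar : φ (star a) = star (φ a) := by
    have e1 := (Complex.nonneg_iff.1 (hφ (1 + a))).2
    have e2 := (Complex.nonneg_iff.1 (hφ (1 + Complex.I • a))).2
    have e3 := (Complex.nonneg_iff.1 (hφ a)).2
    simp [add_mul, mul_add, h1, ← e3] at e1 e2
    refine Complex.ext ?_ ?_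
    · simp; linarith
    · simp; linarith
  have hvar := (Complex.nonneg_iff.1 (hφ (a - φ a • 1))).1
  simp only [star_sub, star_smul, star_one, sub_mul, mul_sub, smul_mul_assoc, mul_smul_comm,
    one_mul, mul_one, map_sub, map_smul, h1, hstar, smul_eq_mul] at hvar
  refine (sq_le_sq₀ (norm_nonneg _) (norm_nonneg a)).1 ?_
  refine le_trans ?_ hle
  rw [Complex.sq_norm, Complex.normSq_apply]
  simp at hvar
  linarith

theorem VonNeumannAlgebra.isClosed_coe {H : Type*} [NormedAddCommGroup H] [InnerProductSpace ℂ H]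
    [CompleteSpace H] (A : VonNeumannAlgebra H) :
    IsClosed (A.toStarSubalgebra : Set (H →L[ℂ] H)) := by
  rw [VonNeumannAlgebra.coe_toStarSubalgebra, ← A.centralizer_centralizer]
  exact Set.isClosed_centralizer _

end State

theorem mainTheorem3 {H : Type*} [NormedAddCommGroup H] [InnerProductSpace ℂ H] [CompleteSpace H]
    (A B : VonNeumannAlgebra H) (hBA : B ≤ A)
    (φ : A.toStarSubalgebra →ₗ[ℂ] ℂ) (hφ : IsFaithfulNormalTracialState φ)
    (Y X : A.toStarSubalgebra) (hY : IsFreeFrom φ Y (vnSubalgebra A B))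
    (hX : X ∈ vnSubalgebra A B) (hXY : ‖X‖ * ‖Y‖ < 1 / 5) :
    Summable (fun n : ℕ => altBooleanCumulant φ Y X n) ∧
    IsUnit (1 - Y * X) ∧ IsUnit (1 - X * Y) ∧ IsUnit (1 - altBooleanGF φ Y X 1 • X) ∧
    IsCondExp φ (vnSubalgebra A B) (Ring.inverse (1 - Y * X) * Y)
      (altBooleanGF φ Y X 1 • Ring.inverse (1 - altBooleanGF φ Y X 1 • X)) ∧
    IsCondExp φ (vnSubalgebra A B) (Ring.inverse (1 - X * Y) * X)
      (X * Ring.inverse (1 - altBooleanGF φ Y X 1 • X)) := by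
  have := A.isClosed_coe
  have : CompleteSpace A.toStarSubalgebra := A.isClosed_coe.completeSpace_coe
  have h1 := hφ.map_one
  have : Nontrivial A.toStarSubalgebra := ⟨1, 0, fun h => by
    rw [h, map_zero] at h1
    exact zero_ne_one h1⟩
  have hb : ∀ a, ‖φ a‖ ≤ ‖a‖ := norm_map_le_of_state (A := A.toStarSubalgebra) h1 hφ.nonneg
  have hS : IsClosed (vnSubalgebra A B : Set A.toStarSubalgebra) :=
    B.isClosed_coe.preimage continuous_subtype_val
  have : NormOneClass A.toStarSubalgebra := ⟨CStarRing.norm_one⟩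
  have hη : altBooleanGF φ Y X 1 = ∑' n, altBooleanCumulant φ Y X n := by simp [altBooleanGF]
  have hsum : Summable fun n => altBooleanCumulant φ Y X n := by
    simpa using (summable_norm_altBooleanCumulant_mul_pow hb h1 X Y (z := 1)
      (by rw [norm_one]; linarith)).of_norm
  have hηX : ‖altBooleanGF φ Y X 1 • X‖ < 1 := by
    have := norm_tsum_altBooleanCumulant_smul_lt hb h1 (X := X) (Y := Y) (z := 1)
      (by rwa [norm_one, one_mul])
    simpa [hη] using this
  have hYX : ‖Y * X‖ < 1 := (norm_mul_le _ _).trans_lt (by linarith)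
  have hXY' : ‖X * Y‖ < 1 := (norm_mul_le _ _).trans_lt (by linarith)
  have hmain : ∀ b ∈ vnSubalgebra A B, φ (Ring.inverse (1 - Y * X) * Y * b) =
      altBooleanGF φ Y X 1 * φ (Ring.inverse (1 - altBooleanGF φ Y X 1 • X) * b) := by
    rw [hη]
    exact fun b hbS => map_inverse_one_sub_mul_mul hb h1 hφ.tracial hS hY hX hXY hbS
  have hRS := inverse_one_sub_mem hS (Subalgebra.smul_mem _ hX (altBooleanGF φ Y X 1)) hηX
  refine ⟨hsum, isUnit_one_sub_of_norm_lt_one hYX, isUnit_one_sub_of_norm_lt_one hXY',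
    isUnit_one_sub_of_norm_lt_one hηX, ⟨Subalgebra.smul_mem _ hRS _, fun b hbS => ?_⟩,
    mul_mem hX hRS, fun b hbS => ?_⟩
  · rw [hmain b hbS, smul_mul_assoc, map_smul, smul_eq_mul]
  · have hU := one_sub_mul_inverse_one_sub hYX
    have hU' := inverse_one_sub_mul_one_sub hYX
    have hV := inverse_one_sub_mul_one_sub hXY'
    have hR := inverse_one_sub_mul_one_sub hηX
    set U := Ring.inverse (1 - Y * X)
    set V := Ring.inverse (1 - X * Y)
    set η := altBooleanGF φ Y X 1
    set R := Ring.inverse (1 - η • X)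
    -- `(1 - XY)⁻¹ X = X (1 - YX)⁻¹ = X + X ((1 - YX)⁻¹ Y) X`
    have eV : V * X = X + X * (U * Y * X) := by
      calc V * X = V * X * ((1 - Y * X) * U) := by rw [hU, mul_one]
        _ = (V * (1 - X * Y)) * X * U := by noncomm_ring
        _ = X * (U * (1 - Y * X)) + X * (U * Y * X) := by rw [hV, one_mul]; noncomm_ring
        _ = _ := by rw [hU', mul_one]
    have eR : R = 1 + η • (R * X) := by
      rw [← mul_smul_comm, ← hR]
      noncomm_ring
    have e1 : φ (X * (U * Y * X) * b) = η * φ (R * X * b * X) := by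
      rw [mul_assoc X, hφ.tracial X, mul_assoc _ X b, mul_assoc _ (X * b) X,
        hmain _ (mul_mem (mul_mem hX hbS) hX)]
      simp only [mul_assoc]
    have e2 : φ (X * R * b) = φ (X * b) + η * φ (R * X * b * X) := by
      rw [mul_assoc, hφ.tracial X]
      conv_lhs => rw [eR]
      rw [add_mul, add_mul, one_mul, map_add, hφ.tracial b, smul_mul_assoc, smul_mul_assoc,
        map_smul, smul_eq_mul]
    rw [eV, add_mul, map_add, e1, e2]
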